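/- Let $(X,\mathcal B,\mu,T)$ be a measure-preserving system, i.e. $(X,\mathcal B,\mu)$ is a probability space and $T:X\to X$ is a measurable, $\mu$-preserving map (not necessarily invertible). For an increasing sequence $S=\{s_1<s_2<\cdots\}$ of positive integers put $$\overline D(S)=\inf\Big\{\tau\ge 0:\ \limsup_{n\to\infty}\frac{n}{s_n^{\tau}}=0\Big\}.$$ For a finite measurable partition $\alpha$ of $X$ let $H_\mu(\alpha)=-\sum_{C\in\alpha}\mu(C)\log\mu(C)$ (with $0\log 0=0$), call $S$ an entropy generating sequence of $\alpha$ if $$\liminf_{n\to\infty}\frac1n H_\mu\Big(\bigvee_{i=1}^n T^{-s_i}\alpha\Big)>0,$$ and let the upper entropy dimension $\overline D_\mu(T,\alpha)$ be the supremum of $\overline D(S)$ over all entropy generating sequences $S$ of $\alpha$ (and $0$ if there are none). The dimension set of the system is $$Dims_\mu(X,T)=\{\overline D_\mu(T,\{A,X\setminus A\}):\ A\in\mathcal B,\ 0<\mu(A)<1\}.$$ If the system has strictly positive entropy dimension, i.e. $0\notin Dims_\mu(X,T)$, then it is weakly mixing, i.e. $T\times T$ is ergodic with respect to $\mu\times\mu$.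 -/

import Mathlib

open MeasureTheory Filter
open scoped NNReal ENNReal

namespace EntropyDim

/-- A finite measurable partition of `X`, with cells labelled by `ι` (empty cells are allowed; they
contribute `0` to every entropy). -/
structure MeasPartition (X : Type*) [MeasurableSpace X] (ι : Type*) [Fintype ι] where
  cell : ι → Set X
  measurable_cell : ∀ i, MeasurableSet (cell i)
  disjoint_cell : Pairwise fun i j => Disjoint (cell i) (cell j)
  iUnion_cell : ⋃ i, cell i = Set.univ

/-- The two-set partition `{A, X \ A}`. -/
def MeasPartition.ofSet {X : Type*} [MeasurableSpace X] (A : Set X) (hA : MeasurableSet A) :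
    MeasPartition X Bool where
  cell b := bif b then A else Aᶜ
  measurable_cell b := by
    cases b
    · exact hA.compl
    · exact hA
  disjoint_cell i j hij := by
    cases i <;> cases j
    · exact absurd rfl hij
    · exact disjoint_compl_left
    · exact disjoint_compl_right
    · exact absurd rfl hij
  iUnion_cell := by
    ext x
    simp only [Set.mem_iUnion, Bool.exists_bool, Set.mem_univ, iff_true]
    exact (em (x ∈ A)).symm

/-- The Shannon entropy `-∑ μ(C) log μ(C)` of a partition into the finitely many cells `c i`. -/
noncomputable def entropy {X : Type*} [MeasurableSpace X] (μ : Measure X) {ι : Type*} [Fintype ι]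
    (c : ι → Set X) : ℝ :=
  ∑ i, Real.negMulLog (μ.real (c i))

/-- The cells of the join of the partitions `T^{-s 0} α, …, T^{-s (n-1)} α`. -/
def joinCells {X : Type*} [MeasurableSpace X] (T : X → X) {ι : Type*} [Fintype ι]
    (α : MeasPartition X ι) (s : ℕ → ℕ) (n : ℕ) : (Fin n → ι) → Set X :=
  fun v => ⋂ i : Fin n, T^[s i] ⁻¹' α.cell (v i)

/-- Increasing sequences of positive integers. Here `s n` is the `(n + 1)`-st term. -/
def IsIncSeq (s : ℕ → ℕ) : Prop :=
  StrictMono s ∧ ∀ n, 0 < s n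

/-- The limit superior of (number of terms) / (last term) `^ τ`. -/
noncomputable def upperDensity (s : ℕ → ℕ) (τ : ℝ≥0) : ℝ≥0∞ :=
  limsup (fun n : ℕ => ((n + 1 : ℕ) : ℝ≥0∞) / ((s n : ℕ) : ℝ≥0∞) ^ (τ : ℝ)) atTop

/-- The upper dimension of an increasing sequence of positive integers. -/
noncomputable def upperDim (s : ℕ → ℕ) : ℝ≥0∞ :=
  ⨅ (τ : ℝ≥0) (_ : upperDensity s τ = 0), (τ : ℝ≥0∞)

/-- The entropy generating sequences of the partition `α`. -/
def entropyGenerating {X : Type*} [MeasurableSpace X] (μ : Measure X) (T : X → X)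
    {ι : Type*} [Fintype ι] (α : MeasPartition X ι) : Set (ℕ → ℕ) :=
  {s | IsIncSeq s ∧
    0 < liminf (fun n : ℕ => ENNReal.ofReal (entropy μ (joinCells T α s n) / n)) atTop}

/-- The upper entropy dimension of the partition `α`: the supremum of the upper dimensions of its
entropy generating sequences, which is `0` if there are none. -/
noncomputable def upperEntropyDim {X : Type*} [MeasurableSpace X] (μ : Measure X) (T : X → X)
    {ι : Type*} [Fintype ι] (α : MeasPartition X ι) : ℝ≥0∞ :=
  ⨆ s ∈ entropyGenerating μ T α, upperDim s

/-- The dimension set of a system. -/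
def dims {X : Type*} [MeasurableSpace X] (μ : Measure X) (T : X → X) : Set ℝ≥0∞ :=
  {d | ∃ (A : Set X) (hA : MeasurableSet A), 0 < μ A ∧ μ A < 1 ∧
    d = upperEntropyDim μ T (MeasPartition.ofSet A hA)}

/-- Strictly positive entropy dimension. -/
def StrictlyPositiveEntropyDim {X : Type*} [MeasurableSpace X] (μ : Measure X) (T : X → X) :
    Prop :=
  (0 : ℝ≥0∞) ∉ dims μ T

/-- Weak mixing: the product system `T × T` is ergodic for the product measure. -/
def WeaklyMixing {X : Type*} [MeasurableSpace X] (μ : Measure X) (T : X → X) : Prop :=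
  Ergodic (Prod.map T T) (μ.prod μ)

end EntropyDim

namespace EntropyDim

open Topology symmDiff

/-! If the preimages `T^{-n} A` are totally bounded in the measure algebra, then up to ε all of them
lie among N fixed sets. Joining n of them thus costs entropy at most N log 2 plus a small multiple
of n, and `A` has no entropy generating sequence. Positive entropy dimension therefore forces `μ A`
to be 0 or 1. Applied to invariant sets, this makes `T` ergodic.

Let `E` be `T × T`-invariant with fibers `E_x`. The pseudometric `μ (E_x ∆ E_y)` is `T ×
T`-invariant, so by ergodicity its ε-balls have the same measure around almost every point. This
measure is positive because `E` is approximable by sets with countably many fibers. Packing disjoint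
balls then gives finite nets. Since `T^{-n} E_{T^n z} = E_z`, choosing `z` with `T^n z` near `x`
places `T^{-n} E_x` near `E_z`, with no inverse of `T` needed. So almost every fiber has a totally
bounded orbit, hence measure 0 or 1; this measure is almost surely that of `E`. -/

/-! ### Entropy bound by noisy coding -/

/-- Gibbs' inequality. -/
theorem sum_negMulLog_le_sum_mul_neg_log {V : Type*} [Fintype V] {p q : V → ℝ}
    (hp : ∀ v, 0 ≤ p v) (hp1 : ∑ v, p v = 1) (hq : ∀ v, 0 < q v) (hq1 : ∑ v, q v = 1) :
    ∑ v, Real.negMulLog (p v) ≤ ∑ v, p v * -Real.log (q v) := by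
  have key : ∀ v, Real.negMulLog (p v) ≤ p v * -Real.log (q v) + (q v - p v) := by
    intro v
    rcases (hp v).eq_or_lt with h | h
    · simp [← h, (hq v).le]
    · have h1 := Real.log_le_sub_one_of_pos (div_pos (hq v) h)
      rw [Real.log_div (hq v).ne' h.ne'] at h1
      have h2 := mul_le_mul_of_nonneg_left h1 h.le
      have h3 : p v * (q v / p v - 1) = q v - p v := by field_simp
      rw [h3] at h2
      simp only [Real.negMulLog]
      linarith
  refine (Finset.sum_le_sum fun v _ => key v).trans ?_
  rw [Finset.sum_add_distrib, Finset.sum_sub_distrib, hp1, hq1]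
  simp

/-- The transition probabilities of the binary symmetric channel with error probability `δ`. -/
noncomputable def bitNoise (δ : ℝ) (a b : Bool) : ℝ := if a = b then 1 - δ else δ

theorem bitNoise_pos {δ : ℝ} (h0 : 0 < δ) (h1 : δ < 1) (a b : Bool) : 0 < bitNoise δ a b := by
  unfold bitNoise
  split_ifs <;> linarith

theorem sum_bitNoise (δ : ℝ) (b : Bool) : ∑ a, bitNoise δ a b = 1 := by
  cases b <;> simp [bitNoise]

theorem neg_log_bitNoise_le {δ : ℝ} (h0 : 0 < δ) (h1 : δ < 1) (a b : Bool) :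
    -Real.log (bitNoise δ a b) ≤ -Real.log (1 - δ) + if a = b then 0 else -Real.log δ := by
  unfold bitNoise
  split_ifs
  · simp
  · have : Real.log (1 - δ) ≤ 0 := Real.log_nonpos (by linarith) (by linarith)
    linarith

/-- The average over all codewords `w : J → Bool` of the product measures obtained by sending the
bits `w (j i)` through independent noisy channels. -/
noncomputable def noisyMixture (δ : ℝ) {n : ℕ} {J : Type*} [Fintype J] [DecidableEq J]
    (j : Fin n → J) (v : Fin n → Bool) : ℝ :=
  ((2 : ℝ) ^ Fintype.card J)⁻¹ * ∑ w : J → Bool, ∏ i, bitNoise δ (v i) (w (j i))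

theorem sum_noisyMixture (δ : ℝ) {n : ℕ} {J : Type*} [Fintype J] [DecidableEq J]
    (j : Fin n → J) : ∑ v, noisyMixture δ j v = 1 := by
  unfold noisyMixture
  rw [← Finset.mul_sum, Finset.sum_comm]
  have h : ∀ w : J → Bool, ∑ v : Fin n → Bool, ∏ i, bitNoise δ (v i) (w (j i)) = 1 := by
    intro w
    rw [← Fintype.prod_sum fun i a => bitNoise δ a (w (j i))]
    simp only [sum_bitNoise, Finset.prod_const_one]
  simp [h]

theorem prod_bitNoise_le_noisyMixture {δ : ℝ} (h0 : 0 < δ) (h1 : δ < 1) {n : ℕ} {J : Type*}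
    [Fintype J] [DecidableEq J] (j : Fin n → J) (v : Fin n → Bool) (w : J → Bool) :
    ((2 : ℝ) ^ Fintype.card J)⁻¹ * ∏ i, bitNoise δ (v i) (w (j i)) ≤ noisyMixture δ j v := by
  unfold noisyMixture
  gcongr
  exact Finset.single_le_sum (f := fun w : J → Bool => ∏ i, bitNoise δ (v i) (w (j i)))
    (fun w _ => Finset.prod_nonneg fun i _ => (bitNoise_pos h0 h1 _ _).le) (Finset.mem_univ w)

theorem noisyMixture_pos {δ : ℝ} (h0 : 0 < δ) (h1 : δ < 1) {n : ℕ} {J : Type*}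
    [Fintype J] [DecidableEq J] (j : Fin n → J) (v : Fin n → Bool) : 0 < noisyMixture δ j v :=
  lt_of_lt_of_le (mul_pos (by positivity) (Finset.prod_pos fun i _ => bitNoise_pos h0 h1 _ _))
    (prod_bitNoise_le_noisyMixture h0 h1 j v fun _ => true)

/-- Keeping only the component `w` of the mixture costs the logarithm of the number of codewords;
each wrong bit costs a further `-log δ`. -/
theorem neg_log_noisyMixture_le {δ : ℝ} (h0 : 0 < δ) (h1 : δ < 1) {n : ℕ} {J : Type*}
    [Fintype J] [DecidableEq J] (j : Fin n → J) (v : Fin n → Bool) (w : J → Bool) :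
    -Real.log (noisyMixture δ j v) ≤ Fintype.card J * Real.log 2 + n * -Real.log (1 - δ) +
      ∑ i, if v i = w (j i) then 0 else -Real.log δ := by
  have hpos := fun i => bitNoise_pos h0 h1 (v i) (w (j i))
  have h := Real.log_le_log (mul_pos (by positivity) (Finset.prod_pos fun i _ => hpos i))
    (prod_bitNoise_le_noisyMixture h0 h1 j v w)
  rw [Real.log_mul (by positivity) (Finset.prod_pos fun i _ => hpos i).ne', Real.log_inv,
    Real.log_pow, Real.log_prod fun i _ => (hpos i).ne'] at h
  have h2 := Finset.sum_le_sum fun (i : Fin n) (_ : i ∈ Finset.univ) =>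
    neg_log_bitNoise_le h0 h1 (v i) (w (j i))
  rw [Finset.sum_add_distrib, Finset.sum_neg_distrib] at h2
  simp only [Finset.sum_const, Finset.card_univ, Fintype.card_fin, nsmul_eq_mul] at h2
  linarith

/-- If each of `n` sets is `ε`-close to one of the sets `B k`, `k : J`, then the partition they
generate has entropy at most `|J| log 2 + n (log (1 / (1 - δ)) + ε log (1 / δ))`. -/
theorem entropy_le_of_measure_symmDiff_le {X : Type*} [MeasurableSpace X] (μ : Measure X)
    [IsProbabilityMeasure μ] {n : ℕ} {J : Type*} [Fintype J] (A : Fin n → Set X)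
    (B : J → Set X) (j : Fin n → J) (hA : ∀ i, MeasurableSet (A i)) (hB : ∀ k, MeasurableSet (B k))
    {ε δ : ℝ} (h0 : 0 < δ) (h1 : δ < 1) (hAB : ∀ i, μ.real (A i ∆ B (j i)) ≤ ε) :
    entropy μ (fun v : Fin n → Bool => ⋂ i, bif v i then A i else (A i)ᶜ) ≤
      Fintype.card J * Real.log 2 + n * (-Real.log (1 - δ) + ε * -Real.log δ) := by
  classical
  set Y : X → Fin n → Bool := fun x i => decide (x ∈ A i) with hY
  have hYm : Measurable Y := measurable_pi_lambda _ fun i => by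
    refine measurable_to_bool ?_
    convert hA i using 1
    ext x; simp [hY]
  have hcell : ∀ v : Fin n → Bool, (⋂ i, bif v i then A i else (A i)ᶜ) = Y ⁻¹' {v} := by
    intro v
    ext x
    simp only [Set.mem_iInter, Set.mem_preimage, Set.mem_singleton_iff, funext_iff, hY]
    refine forall_congr' fun i => ?_
    cases v i <;> simp
  have : IsProbabilityMeasure (μ.map Y) := Measure.isProbabilityMeasure_map hYm.aemeasurable
  have hreal : ∀ v, (μ.map Y).real {v} = μ.real (Y ⁻¹' {v}) := fun v => by
    rw [map_measureReal_apply hYm (measurableSet_singleton v)]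
  have hsum : ∀ g : (Fin n → Bool) → ℝ, ∑ v, μ.real (Y ⁻¹' {v}) * g v = ∫ x, g (Y x) ∂μ := by
    intro g
    rw [← integral_map hYm.aemeasurable (Measurable.of_discrete).aestronglyMeasurable,
      integral_fintype (Integrable.of_finite)]
    simp [hreal]
  have hgibbs := sum_negMulLog_le_sum_mul_neg_log (p := fun v => μ.real (Y ⁻¹' {v}))
    (fun v => measureReal_nonneg) (by simpa using hsum fun _ => 1)
    (fun v => noisyMixture_pos h0 h1 j v) (sum_noisyMixture δ j)
  simp only [entropy, hcell]
  refine hgibbs.trans ?_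
  rw [hsum fun v => -Real.log (noisyMixture δ j v)]
  have hm : ∀ i, MeasurableSet (A i ∆ B (j i)) := fun i => (hA i).symmDiff (hB (j i))
  have hind : ∀ i, Integrable ((A i ∆ B (j i)).indicator fun _ => -Real.log δ) μ := fun i =>
    (integrable_const _).indicator (hm i)
  have hbound : ∀ x, -Real.log (noisyMixture δ j (Y x)) ≤
      (Fintype.card J * Real.log 2 + n * -Real.log (1 - δ)) +
        ∑ i, (A i ∆ B (j i)).indicator (fun _ => -Real.log δ) x := by
    intro x
    -- The codeword may depend on `x`: with membership in the `B k` as bits, an error at `i` means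
    -- exactly `x ∈ A i ∆ B (j i)`.
    refine (neg_log_noisyMixture_le h0 h1 j (Y x) fun k => decide (x ∈ B k)).trans_eq ?_
    congr 1
    refine Finset.sum_congr rfl fun i _ => ?_
    by_cases ha : x ∈ A i <;> by_cases hb : x ∈ B (j i) <;>
      simp [hY, ha, hb, Set.indicator, Set.mem_symmDiff]
  have hint : Integrable (fun x => -Real.log (noisyMixture δ j (Y x))) μ := by
    have : Integrable (fun v => -Real.log (noisyMixture δ j v)) (μ.map Y) := Integrable.of_finite
    exact this.comp_measurable hYm
  refine (integral_mono hint
    ((integrable_const _).add (integrable_finsetSum _ fun i _ => hind i)) hbound).trans ?_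
  simp only [Pi.add_apply]
  rw [integral_add (integrable_const _) (integrable_finsetSum _ fun i _ => hind i),
    integral_finsetSum _ fun i _ => hind i]
  simp only [integral_indicator_const _ (hm _), integral_const, probReal_univ, smul_eq_mul, one_mul]
  have hlog : 0 ≤ -Real.log δ := neg_nonneg.2 (Real.log_nonpos h0.le h1.le)
  have := Finset.sum_le_sum fun (i : Fin n) (_ : i ∈ Finset.univ) =>
    mul_le_mul_of_nonneg_right (hAB i) hlog
  simp only [Finset.sum_const, Finset.card_univ, Fintype.card_fin, nsmul_eq_mul] at this
  linarith

/-! ### Totally bounded orbits generate no entropy -/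

/-- The backward orbit of `A` is totally bounded in the measure algebra of `μ`. -/
def HasTotallyBoundedOrbit {X : Type*} [MeasurableSpace X] (μ : Measure X) (T : X → X)
    (A : Set X) : Prop :=
  ∀ ε : ℝ, 0 < ε → ∃ (N : ℕ) (B : Fin N → Set X), (∀ k, MeasurableSet (B k)) ∧
    ∀ n, ∃ k, μ.real ((T^[n] ⁻¹' A) ∆ B k) ≤ ε

/-- The order matters: δ is fixed first, then ε is taken small against `-log δ`. -/
theorem exists_noise_lt {η : ℝ} (hη : 0 < η) :
    ∃ δ ε : ℝ, 0 < δ ∧ δ < 1 ∧ 0 < ε ∧ -Real.log (1 - δ) + ε * -Real.log δ < η := by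
  have h1 : Tendsto (fun δ : ℝ => -Real.log (1 - δ)) (𝓝 0) (𝓝 0) := by
    have : ContinuousAt (fun δ : ℝ => -Real.log (1 - δ)) 0 :=
      ((continuousAt_const.sub continuousAt_id).log (by simp)).neg
    simpa [ContinuousAt] using this
  have h2 : ∀ᶠ δ in 𝓝[>] (0 : ℝ), -Real.log (1 - δ) < η ∧ δ < 1 ∧ 0 < δ :=
    ((h1.mono_left nhdsWithin_le_nhds).eventually_lt_const hη).and
      (((eventually_lt_nhds one_pos).filter_mono nhdsWithin_le_nhds).and
        eventually_mem_nhdsWithin)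
  obtain ⟨δ, hδ, hδ1, hδ0⟩ := h2.exists
  have h3 : Tendsto (fun ε : ℝ => -Real.log (1 - δ) + ε * -Real.log δ) (𝓝 0)
      (𝓝 (-Real.log (1 - δ))) := by
    have : Continuous (fun ε : ℝ => -Real.log (1 - δ) + ε * -Real.log δ) := by fun_prop
    simpa using this.tendsto 0
  have h4 : ∀ᶠ ε in 𝓝[>] (0 : ℝ), -Real.log (1 - δ) + ε * -Real.log δ < η ∧ 0 < ε :=
    ((h3.mono_left nhdsWithin_le_nhds).eventually_lt_const hδ).and eventually_mem_nhdsWithin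
  obtain ⟨ε, hε, hε0⟩ := h4.exists
  exact ⟨δ, ε, hδ0, hδ1, hε0, hε⟩

theorem HasTotallyBoundedOrbit.entropyGenerating_eq_empty {X : Type*} [MeasurableSpace X]
    {μ : Measure X} [IsProbabilityMeasure μ] {T : X → X} (hT : Measurable T) {A : Set X}
    (hA : MeasurableSet A) (h : HasTotallyBoundedOrbit μ T A) :
    entropyGenerating μ T (MeasPartition.ofSet A hA) = ∅ := by
  rw [Set.eq_empty_iff_forall_notMem]
  rintro s ⟨-, hs⟩
  refine hs.not_ge (le_of_forall_gt_imp_ge_of_dense fun a ha => ?_)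
  obtain ⟨η, hη0, hηa⟩ : ∃ η : ℝ, 0 < η ∧ ENNReal.ofReal η ≤ a := by
    obtain ⟨r, hr0, hra⟩ := ENNReal.lt_iff_exists_nnreal_btwn.1 ha
    exact ⟨r, by exact_mod_cast hr0, by simpa using hra.le⟩
  obtain ⟨δ, ε, h0, h1, hε, hlt⟩ := exists_noise_lt (half_pos hη0)
  obtain ⟨N, B, hB, hN⟩ := h ε hε
  choose k hk using hN
  have hN' : ∀ᶠ n : ℕ in atTop, (N * Real.log 2) / (n : ℝ) < η / 2 :=
    (tendsto_const_div_atTop_nhds_zero_nat _).eventually_lt_const (half_pos hη0)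
  refine liminf_le_of_frequently_le' (Eventually.frequently ?_)
  filter_upwards [hN', eventually_gt_atTop 0] with n hn hn0
  refine (ENNReal.ofReal_le_ofReal ?_).trans hηa
  have hbd := entropy_le_of_measure_symmDiff_le μ (fun i : Fin n => T^[s i] ⁻¹' A) B
    (fun i => k (s i)) (fun i => hT.iterate (s i) hA) hB h0 h1 (fun i => hk (s i))
  have hcells : joinCells T (MeasPartition.ofSet A hA) s n =
      fun v => ⋂ i : Fin n, bif v i then T^[s i] ⁻¹' A else (T^[s i] ⁻¹' A)ᶜ := by
    funext v
    refine Set.iInter_congr fun i => ?_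
    cases hv : v i <;> simp [MeasPartition.ofSet]
  rw [hcells]
  have hnpos : (0 : ℝ) < n := by exact_mod_cast hn0
  rw [div_lt_iff₀ hnpos] at hn
  rw [div_le_iff₀ hnpos]
  refine hbd.trans ?_
  have := mul_le_mul_of_nonneg_left hlt.le hnpos.le
  rw [Fintype.card_fin]
  linarith

theorem HasTotallyBoundedOrbit.zero_mem_dims {X : Type*} [MeasurableSpace X]
    {μ : Measure X} [IsProbabilityMeasure μ] {T : X → X} (hT : Measurable T) {A : Set X}
    (hA : MeasurableSet A) (h : HasTotallyBoundedOrbit μ T A) (h0 : 0 < μ A) (h1 : μ A < 1) :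
    0 ∈ dims μ T :=
  ⟨A, hA, h0, h1, by simp [upperEntropyDim, h.entropyGenerating_eq_empty hT hA]⟩

/-! ### Fibers of invariant subsets of the square -/

theorem preimage_fiber {X : Type*} {T : X → X} {E : Set (X × X)}
    (hET : Prod.map T T ⁻¹' E = E) (x : X) :
    T ⁻¹' (Prod.mk (T x) ⁻¹' E) = Prod.mk x ⁻¹' E := by
  ext y
  exact Set.ext_iff.1 hET (x, y)

theorem preimage_iterate_fiber {X : Type*} {T : X → X} {E : Set (X × X)}
    (hET : Prod.map T T ⁻¹' E = E) (n : ℕ) (x : X) :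
    T^[n] ⁻¹' (Prod.mk (T^[n] x) ⁻¹' E) = Prod.mk x ⁻¹' E := by
  induction n generalizing x with
  | zero => rfl
  | succ n ih =>
    rw [Function.iterate_succ, Set.preimage_comp, Function.comp_apply, ih, preimage_fiber hET]

section Fibers

variable {X : Type*} [MeasurableSpace X]

/-- The measure of the symmetric difference of the fibers `E_x` and `E_y` of `E ⊆ X × X`. -/
noncomputable def fiberDist (μ : Measure X) (E : Set (X × X)) (x y : X) : ℝ≥0∞ :=
  μ ((Prod.mk x ⁻¹' E) ∆ (Prod.mk y ⁻¹' E))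

theorem fiberDist_comm (μ : Measure X) (E : Set (X × X)) (x y : X) :
    fiberDist μ E x y = fiberDist μ E y x := by
  rw [fiberDist, fiberDist, symmDiff_comm]

theorem fiberDist_triangle (μ : Measure X) (E : Set (X × X)) (x y z : X) :
    fiberDist μ E x z ≤ fiberDist μ E x y + fiberDist μ E y z :=
  measure_symmDiff_le _ _ _

theorem measurable_fiberDist (μ : Measure X) [SFinite μ] {E : Set (X × X)} (hE : MeasurableSet E) :
    Measurable fun p : X × X => fiberDist μ E p.1 p.2 := by
  have h1 : MeasurableSet {q : (X × X) × X | (q.1.1, q.2) ∈ E} :=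
    hE.preimage (by fun_prop : Measurable fun q : (X × X) × X => (q.1.1, q.2))
  have h2 : MeasurableSet {q : (X × X) × X | (q.1.2, q.2) ∈ E} :=
    hE.preimage (by fun_prop : Measurable fun q : (X × X) × X => (q.1.2, q.2))
  exact measurable_measure_prodMk_left (ν := μ) (h1.symmDiff h2)

theorem measurableSet_fiberBall (μ : Measure X) [SFinite μ] {E : Set (X × X)}
    (hE : MeasurableSet E) (ε : ℝ≥0∞) : MeasurableSet {p : X × X | fiberDist μ E p.1 p.2 < ε} :=
  measurableSet_lt (measurable_fiberDist μ hE) measurable_const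

/-- Measurable subsets of `X × X` with countably many distinct fibers, forming a measurable
partition of `X`. -/
def countablyFibered (X : Type*) [MeasurableSpace X] : Set (Set (X × X)) :=
  {S | MeasurableSet S ∧ ∃ κ : X → ℕ, Measurable κ ∧
    ∀ x y, κ x = κ y → ∀ z, (x, z) ∈ S ↔ (y, z) ∈ S}

theorem isSetAlgebra_countablyFibered : IsSetAlgebra (countablyFibered X) where
  empty_mem := ⟨MeasurableSet.empty, fun _ => 0, measurable_const, by simp⟩
  compl_mem := by
    rintro S ⟨hS, κ, hκ, h⟩
    exact ⟨hS.compl, κ, hκ, fun x y hxy z => not_congr (h x y hxy z)⟩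
  union_mem := by
    rintro S S' ⟨hS, κ, hκ, h⟩ ⟨hS', κ', hκ', h'⟩
    refine ⟨hS.union hS', fun x => Nat.pair (κ x) (κ' x),
      (Measurable.of_discrete (f := fun p : ℕ × ℕ => Nat.pair p.1 p.2)).comp (hκ.prodMk hκ'), ?_⟩
    intro x y hxy z
    obtain ⟨h1, h2⟩ := Nat.pair_eq_pair.1 hxy
    exact or_congr (h x y h1 z) (h' x y h2 z)

/-- A measurable rectangle has at most two distinct fibers. -/
theorem generateFrom_countablyFibered :
    (inferInstance : MeasurableSpace (X × X)) =
      MeasurableSpace.generateFrom (countablyFibered X) := by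
  classical
  refine le_antisymm ?_ (MeasurableSpace.generateFrom_le fun S hS => hS.1)
  rw [← generateFrom_prod]
  refine MeasurableSpace.generateFrom_mono ?_
  rintro _ ⟨s, hs, t, ht, rfl⟩
  refine ⟨hs.prod ht, s.indicator fun _ => 1, measurable_const.indicator hs, ?_⟩
  intro x y hxy z
  by_cases hx : x ∈ s <;> by_cases hy : y ∈ s <;> simp_all [Set.indicator]

/-- The fibers of a measurable set form an almost separable family. -/
theorem prod_fiberDist_lt_ne_zero (μ : Measure X) [IsProbabilityMeasure μ] {E : Set (X × X)}
    (hE : MeasurableSet E) {ε : ℝ} (hε : 0 < ε) :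
    (μ.prod μ) {p | fiberDist μ E p.1 p.2 < ENNReal.ofReal ε} ≠ 0 := by
  obtain ⟨F, ⟨hF, κ, hκ, hκF⟩, hEF⟩ := (Measure.MeasureDense.of_generateFrom_isSetAlgebra_finite
    (μ.prod μ) isSetAlgebra_countablyFibered generateFrom_countablyFibered).approx E hE
    (measure_ne_top _ _) (ε / 2) (half_pos hε)
  have hD : MeasurableSet (E ∆ F) := hE.symmDiff hF
  set φ : X → ℝ≥0∞ := fun x => μ (Prod.mk x ⁻¹' (E ∆ F)) with hφ
  rw [Measure.prod_apply hD] at hEF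
  have hgood : 0 < μ {x | φ x ≤ ∫⁻ a, φ a ∂μ} :=
    measure_le_lintegral_pos (measurable_measure_prodMk_left hD).aemeasurable
  -- Countably many labels split a set of positive measure, so one label class meets it in positive
  -- measure.
  obtain ⟨k, hk⟩ : ∃ k, μ ({x | φ x ≤ ∫⁻ a, φ a ∂μ} ∩ κ ⁻¹' {k}) ≠ 0 := by
    by_contra! hcon
    refine hgood.ne' (measure_mono_null ?_ (measure_iUnion_null hcon))
    intro x hx
    exact Set.mem_iUnion.2 ⟨κ x, hx, rfl⟩
  set G := {x | φ x ≤ ∫⁻ a, φ a ∂μ} ∩ κ ⁻¹' {k}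
  have hsub : G ×ˢ G ⊆ {p | fiberDist μ E p.1 p.2 < ENNReal.ofReal ε} := by
    rintro ⟨x, y⟩ ⟨⟨hx, hkx⟩, ⟨hy, hky⟩⟩
    have hxy : Prod.mk x ⁻¹' F = Prod.mk y ⁻¹' F := by
      ext z
      exact hκF x y (hkx.trans hky.symm) z
    have h1 : fiberDist μ E x y ≤ φ x + φ y := by
      refine (measure_symmDiff_le _ (Prod.mk x ⁻¹' F) _).trans ?_
      gcongr
      · exact le_of_eq rfl
      · rw [hxy, symmDiff_comm]
        exact le_of_eq rfl
    refine (h1.trans (add_le_add hx hy)).trans_lt ?_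
    rw [← add_halves ε, ENNReal.ofReal_add (half_pos hε).le (half_pos hε).le]
    exact ENNReal.add_lt_add hEF hEF
  intro h0
  have := measure_mono_null hsub h0
  rw [Measure.prod_prod] at this
  exact (mul_ne_zero hk hk) this

variable {μ : Measure X} {T : X → X} {E : Set (X × X)}

theorem fiberDist_map (hT : MeasurePreserving T μ μ) (hE : MeasurableSet E)
    (hET : Prod.map T T ⁻¹' E = E) (x y : X) :
    fiberDist μ E (T x) (T y) = fiberDist μ E x y := by
  unfold fiberDist
  rw [← hT.measure_preimage (((measurable_prodMk_left hE).symmDiff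
    (measurable_prodMk_left hE)).nullMeasurableSet), Set.preimage_symmDiff, preimage_fiber hET,
    preimage_fiber hET]

/-- For ergodic `T`, the measure of the fibers of an invariant set is almost surely constant. -/
theorem ae_measure_fiber_eq [IsProbabilityMeasure μ] (hT : Ergodic T μ) (hE : MeasurableSet E)
    (hET : Prod.map T T ⁻¹' E = E) :
    ∀ᵐ x ∂μ, μ (Prod.mk x ⁻¹' E) = (μ.prod μ) E := by
  obtain ⟨c, hc⟩ := hT.toPreErgodic.ae_eq_const_of_ae_eq_comp
    (measurable_measure_prodMk_left (ν := μ) hE) (by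
      funext x
      simp only [Function.comp_apply]
      rw [← hT.toMeasurePreserving.measure_preimage (measurable_prodMk_left hE).nullMeasurableSet,
        preimage_fiber hET])
  have : (μ.prod μ) E = c := by
    rw [Measure.prod_apply hE, lintegral_congr_ae hc]
    simp
  rw [this]
  exact hc

/-- For ergodic `T`, almost every fiber of an invariant set has balls of positive measure, with
measure depending only on the radius. -/
theorem ae_measure_fiberBall_eq [IsProbabilityMeasure μ] (hT : Ergodic T μ) (hE : MeasurableSet E)
    (hET : Prod.map T T ⁻¹' E = E) {ε : ℝ} (hε : 0 < ε) :
    ∃ c ≠ 0, ∀ᵐ x ∂μ, μ {y | fiberDist μ E x y < ENNReal.ofReal ε} = c := by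
  have hB := measurableSet_fiberBall μ hE (ENNReal.ofReal ε)
  have hinv : Prod.map T T ⁻¹' {p | fiberDist μ E p.1 p.2 < ENNReal.ofReal ε} =
      {p | fiberDist μ E p.1 p.2 < ENNReal.ofReal ε} := by
    ext p
    simp [fiberDist_map hT.toMeasurePreserving hE hET]
  -- The ε-neighbourhood of the diagonal is itself invariant, and its fibers are the balls.
  exact ⟨_, prod_fiberDist_lt_ne_zero μ hE hε, ae_measure_fiber_eq hT hB hinv⟩

/-- A set all of whose points have `ε`-balls of the same positive measure is totally bounded at
scale `2 ε`. -/
theorem exists_finset_fiberDist_lt [IsProbabilityMeasure μ] (hE : MeasurableSet E)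
    {ε c : ℝ≥0∞} (hc : c ≠ 0) {G : Set X}
    (hG : ∀ x ∈ G, μ {y | fiberDist μ E x y < ε} = c) :
    ∃ F : Finset X, ∀ x ∈ G, ∃ y ∈ F, fiberDist μ E y x < ε + ε := by
  by_contra! hcon
  -- Without a finite net, a greedy choice yields infinitely many `2ε`-separated points.
  obtain ⟨f, hfG, hf⟩ := exists_seq_of_forall_finset_exists (· ∈ G)
    (fun y x => ε + ε ≤ fiberDist μ E y x) (fun F _ => hcon F)
  have hdisj : Pairwise (Function.onFun Disjoint fun n => {y | fiberDist μ E (f n) y < ε}) := by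
    rw [pairwise_disjoint_on]
    intro m n hmn
    rw [Set.disjoint_left]
    intro y hm hn
    refine (hf m n hmn).not_gt ((fiberDist_triangle μ E (f m) y (f n)).trans_lt ?_)
    rw [fiberDist_comm μ E y]
    exact ENNReal.add_lt_add hm hn
  have hsum := measure_iUnion (μ := μ) hdisj fun n =>
    measurable_prodMk_left (measurableSet_fiberBall μ hE ε)
  have htop : ∑' n, μ {y | fiberDist μ E (f n) y < ε} = ⊤ := by
    simp_rw [fun n => hG (f n) (hfG n)]
    exact ENNReal.tsum_const_eq_top_of_ne_zero hc
  exact measure_ne_top μ _ (hsum.trans htop)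

/-- For ergodic `T`, almost every fiber of a `T × T`-invariant set has a totally bounded orbit. -/
theorem ae_hasTotallyBoundedOrbit_fiber [IsProbabilityMeasure μ] (hT : Ergodic T μ)
    (hE : MeasurableSet E) (hET : Prod.map T T ⁻¹' E = E) :
    ∀ᵐ x ∂μ, HasTotallyBoundedOrbit μ T (Prod.mk x ⁻¹' E) := by
  have hpos : ∀ n : ℕ, (0 : ℝ) < 1 / ((n : ℝ) + 1) := fun n => by positivity
  choose c hc0 hc using fun n : ℕ => ae_measure_fiberBall_eq hT hE hET (hpos n)
  filter_upwards [ae_all_iff.2 hc] with x hx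
  intro ε hε
  obtain ⟨m, hm⟩ := exists_nat_one_div_lt (show 0 < ε / 3 by positivity)
  set r := ENNReal.ofReal (1 / ((m : ℝ) + 1)) with hr
  obtain ⟨F, hF⟩ := exists_finset_fiberDist_lt hE (hc0 m)
    (G := {x | μ {y | fiberDist μ E x y < r} = c m}) fun x hx => hx
  refine ⟨F.card, fun k => Prod.mk (F.equivFin.symm k : X) ⁻¹' E,
    fun k => measurable_prodMk_left hE, fun n => ?_⟩
  have hball : MeasurableSet {y | fiberDist μ E x y < r} :=
    measurable_prodMk_left (measurableSet_fiberBall μ hE r)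
  have hn : μ (T^[n] ⁻¹' {y | fiberDist μ E x y < r}) ≠ 0 := by
    rw [(hT.toMeasurePreserving.iterate n).measure_preimage hball.nullMeasurableSet, hx m]
    exact hc0 m
  -- `T^n z` lies in the ball of `x`, while `z` is generic and so within `2r` of the net; the total
  -- error is `3r < ε`.
  obtain ⟨z, hz, hzG⟩ := ((frequently_ae_mem_iff.2 hn).and_eventually (hc m)).exists
  obtain ⟨y, hyF, hy⟩ := hF z hzG
  refine ⟨F.equivFin ⟨y, hyF⟩, ?_⟩
  simp only [Equiv.symm_apply_apply]
  have h1 : μ ((T^[n] ⁻¹' (Prod.mk x ⁻¹' E)) ∆ (Prod.mk z ⁻¹' E)) < r := by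
    rw [← preimage_iterate_fiber hET n z, ← Set.preimage_symmDiff,
      (hT.toMeasurePreserving.iterate n).measure_preimage ((measurable_prodMk_left hE).symmDiff
        (measurable_prodMk_left hE)).nullMeasurableSet]
    exact hz
  have h2 : μ ((T^[n] ⁻¹' (Prod.mk x ⁻¹' E)) ∆ (Prod.mk y ⁻¹' E)) ≤ r + (r + r) := by
    refine (measure_symmDiff_le _ (Prod.mk z ⁻¹' E) _).trans (add_le_add h1.le ?_)
    rw [symmDiff_comm]
    exact hy.le
  refine ENNReal.toReal_le_of_le_ofReal hε.le (h2.trans ?_)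
  rw [hr, ← ENNReal.ofReal_add (hpos m).le (hpos m).le,
    ← ENNReal.ofReal_add (hpos m).le (add_pos (hpos m) (hpos m)).le]
  exact ENNReal.ofReal_le_ofReal (by linarith)

end Fibers

/-! ### Ergodicity and weak mixing -/

theorem HasTotallyBoundedOrbit.of_preimage_eq {X : Type*} [MeasurableSpace X] (μ : Measure X)
    {T : X → X} {A : Set X} (hA : MeasurableSet A) (h : T ⁻¹' A = A) :
    HasTotallyBoundedOrbit μ T A := by
  intro ε hε
  refine ⟨1, fun _ => A, fun _ => hA, fun n => ⟨0, ?_⟩⟩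
  have : T^[n] ⁻¹' A = A := by
    rw [Set.preimage_iterate_eq]
    exact Function.iterate_fixed h n
  simp [this, hε.le]

theorem StrictlyPositiveEntropyDim.measure_eq_zero_or_one {X : Type*} [MeasurableSpace X]
    {μ : Measure X} [IsProbabilityMeasure μ] {T : X → X} (hpos : StrictlyPositiveEntropyDim μ T)
    (hT : Measurable T) {A : Set X} (hA : MeasurableSet A) (h : HasTotallyBoundedOrbit μ T A) :
    μ A = 0 ∨ μ A = 1 := by
  by_contra! hcon
  exact hpos (h.zero_mem_dims hT hA (pos_iff_ne_zero.2 hcon.1) (prob_le_one.lt_of_ne hcon.2))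

theorem eventuallyConst_ae_of_measure {X : Type*} [MeasurableSpace X] {μ : Measure X}
    [IsProbabilityMeasure μ] {A : Set X} (hA : MeasurableSet A) (h : μ A = 0 ∨ μ A = 1) :
    EventuallyConst A (ae μ) := by
  rw [eventuallyConst_set']
  rcases h with h | h
  · exact Or.inl (ae_eq_empty.2 h)
  · exact Or.inr (ae_eq_univ.2 ((prob_compl_eq_zero_iff hA).2 h))

theorem StrictlyPositiveEntropyDim.ergodic {X : Type*} [MeasurableSpace X]
    {μ : Measure X} [IsProbabilityMeasure μ] {T : X → X} (hpos : StrictlyPositiveEntropyDim μ T)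
    (hT : MeasurePreserving T μ μ) : Ergodic T μ where
  toMeasurePreserving := hT
  aeconst_set _ hA h := eventuallyConst_ae_of_measure hA <|
    hpos.measure_eq_zero_or_one hT.measurable hA (.of_preimage_eq μ hA h)

end EntropyDim

theorem mainTheorem12 {X : Type*} [MeasurableSpace X] (μ : Measure X) [IsProbabilityMeasure μ]
    (T : X → X) (hT : MeasurePreserving T μ μ)
    (hpos : EntropyDim.StrictlyPositiveEntropyDim μ T) :
    EntropyDim.WeaklyMixing μ T := by
  have hErg := hpos.ergodic hT
  refine { toMeasurePreserving := hT.prod hT, aeconst_set := fun E hE hET => ?_ }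
  refine EntropyDim.eventuallyConst_ae_of_measure hE ?_
  obtain ⟨x, hx, hx'⟩ := ((EntropyDim.ae_measure_fiber_eq hErg hE hET).and
    (EntropyDim.ae_hasTotallyBoundedOrbit_fiber hErg hE hET)).exists
  rw [← hx]
  exact hpos.measure_eq_zero_or_one hT.measurable (measurable_prodMk_left hE) hx'
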